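/- **Setting.** Let $n\ge 1$, $m\ge 0$ and $h\ge 1$ be integers, $K\ge 0$ an integer, $X\subseteq\mathbb R^m$, and let $\mathcal A$ be the set of functions $u:\mathbb Z^n\to X$, written $j\mapsto u^j$. Let $Q=(-\tfrac12,\tfrac12]^n$ (half-open, so that the cells $jh+hQ$, $j\in\mathbb Z^n$, tile both $\mathbb R^n$ and $\mathbb Z^n$), and write $|\cdot|$ for Lebesgue measure. Let $L\in\mathbb R$, let $\phi:\mathcal A\to[0,L]$, and for $\varepsilon>0$ set $$F_\varepsilon(u)=\sum_{i\in\mathbb Z^n}\varepsilon^{n-1}\phi(\{u^{i+j}\}_{j\in\mathbb Z^n})\in[0,\infty].$$ Let $v_1,\dots,v_K\in\mathcal A$ be pairwise distinct and $h$-periodic, i.e. $v_l^{j+he_k}=v_l^j$ for all $j\in\mathbb Z^n$ and $1\le k\le n$. Assume **(H2)** there exist integers $M'\ge M\ge 2$ and $C_M>0$ such that, whenever $u\in\mathcal A$ and $i\in\mathbb Z^n$ are such that for every $l\in\{1,\dots,K\}$ there is $j\in (i+MhQ)\cap\mathbb Z^n$ with $u^j\ne v_l^j$, there exists $i_M\in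 (i+M'hQ)\cap\mathbb Z^n$ with $\phi(\{u^{i_M+j}\}_{j\in\mathbb Z^n})\ge C_M$. For $u\in\mathcal A$ put $I_l(u)=\{j\in\mathbb Z^n:\ u^i=v_l^i\text{ for all }i\in(jh+hQ)\cap\mathbb Z^n\}$ and $A_{\varepsilon,l}(u)=\bigcup_{j\in I_l(u)}\varepsilon(jh+hQ)$. For a sequence $\varepsilon_k\to0^+$ and $u_k\in\mathcal A$, say that $u_k$ *converges* to the $K$-tuple $\mathbb A=(A_1,\dots,A_K)$ of subsets of $\mathbb R^n$ if $|(A_{\varepsilon_k,l}(u_k)\,\Delta\, A_l)\cap RQ|\to0$ for all $l\in\{1,\dots,K\}$ and all $R>0$. A set $A\subseteq\mathbb R^n$ has *finite perimeter* in $\mathbb R^n$ if it is Lebesgue measurable and the distributional derivative of its characteristic function is a bounded $\mathbb R^n$-valued measure. **Theorem 3.5 (compactness).** Let $\varepsilon_k>0$ with $\varepsilon_k\to0$ and let $u_k\in\mathcal A$ satisfy $\sup_kF_{\varepsilon_k}(u_k)<\infty$. Then there are a subsequence (not relabelled) and a $K$-tuple $\mathbb A=(A_1,\dots,A_K)$ such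 that $u_k$ converges to $\mathbb A$ along it, every $A_l$ is a set of finite perimeter in $\mathbb R^n$, and the sets $A_1,\dots,A_K$ form a partition of $\mathbb R^n$ (they are pairwise disjoint, possibly empty, and their union is $\mathbb R^n$). -/

import Mathlib

open MeasureTheory Filter Topology
open scoped ENNReal Pointwise symmDiff ContDiff

noncomputable section

namespace LatticePhases

/-- The space `ℝⁿ` with its Euclidean norm. -/
abbrev Space (n : ℕ) : Type := EuclideanSpace ℝ (Fin n)

/-- The lattice `ℤⁿ`. -/
abbrev IntLattice (n : ℕ) : Type := Fin n → ℤ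

/-- The class `𝒜` of lattice functions `u : ℤⁿ → X`. -/
abbrev Config (n : ℕ) {m : ℕ} (X : Set (Space m)) : Type := IntLattice n → X

/-- The lattice point `i ∈ ℤⁿ`, seen in `ℝⁿ`. -/
def toSpace {n : ℕ} (i : IntLattice n) : Space n := WithLp.toLp 2 fun k => (i k : ℝ)

/-- The cube `x + sQ` with center `x` and side length `s`, where `Q = (-1/2, 1/2]ⁿ`.
The cube is half-open, so that its translates of step `s` tile `ℝⁿ` (and, when `s` is a positive
integer and the translations are integral, also `ℤⁿ`). -/
def cube {n : ℕ} (x : Space n) (s : ℝ) : Set (Space n) :=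
  {y | ∀ k, x k - s / 2 < y k ∧ y k ≤ x k + s / 2}

section Discrete

variable {n m K : ℕ} {X : Set (Space m)}

/-- The translation `{u^{i+j}}_j` of `u` by `i`. -/
def shiftBy (i : IntLattice n) (u : Config n X) : Config n X := fun j => u (i + j)

/-- `v` is `h`-periodic: `v^{j + h e_k} = v^j` for every `j` and every coordinate direction `k`. -/
def IsPeriodic (h : ℕ) (v : Config n X) : Prop :=
  ∀ (k : Fin n) (j : IntLattice n), v (j + Pi.single k (h : ℤ)) = v j

/-- The energy `F_ε(u) = ∑_{i ∈ ℤⁿ} ε^{n-1} φ({u^{i+j}}_j)`, a sum of non-negative terms with value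
in `[0, ∞]`. -/
def energy (φ : Config n X → ℝ) (ε : ℝ) (u : Config n X) : ℝ≥0∞ :=
  ∑' i : IntLattice n, ENNReal.ofReal (ε ^ (n - 1) * φ (shiftBy i u))

/-- Coerciveness of the potential `φ` with respect to the `h`-periodic functions `v_l`. -/
def Coercive (φ : Config n X → ℝ) (h : ℕ) (v : Fin K → Config n X) : Prop :=
  ∃ M M' : ℕ, 2 ≤ M ∧ M ≤ M' ∧ ∃ C : ℝ, 0 < C ∧
    ∀ (u : Config n X) (i : IntLattice n),
      (∀ l, ∃ j : IntLattice n, toSpace j ∈ cube (toSpace i) ((M : ℝ) * h) ∧ u j ≠ v l j) →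
      ∃ i' : IntLattice n, toSpace i' ∈ cube (toSpace i) ((M' : ℝ) * h) ∧ C ≤ φ (shiftBy i' u)

/-- The set `I_l(u)` of the labels `j ∈ ℤⁿ` of the cells `jh + hQ` on which `u` coincides with the
function `w = v_l`. -/
def phaseLabels (h : ℕ) (w u : Config n X) : Set (IntLattice n) :=
  {j | ∀ i : IntLattice n, toSpace i ∈ cube ((h : ℝ) • toSpace j) h → u i = w i}

/-- The phase `A_{ε,l}(u) = ⋃_{j ∈ I_l(u)} ε (jh + hQ)`, with `w = v_l`. -/
def phase (h : ℕ) (w : Config n X) (ε : ℝ) (u : Config n X) : Set (Space n) :=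
  ⋃ j ∈ phaseLabels h w u, ε • cube ((h : ℝ) • toSpace j) h

/-- Discrete-to-continuum convergence of the functions `u k` (at scale `ε k`) to the `K`-tuple of
sets `A`: `|(A_{ε,l}(u_ε) Δ A_l) ∩ RQ| → 0` for every `l` and every `R > 0`. -/
def ConvergesTo (h : ℕ) (v : Fin K → Config n X) (ε : ℕ → ℝ) (u : ℕ → Config n X)
    (A : Fin K → Set (Space n)) : Prop :=
  ∀ l, ∀ R : ℝ, 0 < R →
    Tendsto (fun k => volume ((phase h (v l) (ε k) (u k) ∆ A l) ∩ cube 0 R)) atTop (𝓝 0)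

end Discrete

/-- `A ⊆ ℝⁿ` has finite perimeter in `ℝⁿ`: it is Lebesgue measurable and the distributional
derivative of its characteristic function is a bounded `ℝⁿ`-valued measure `D = (D_1, …, D_n)`, i.e.
`∫ f dD_k = - ∫_A ∂_k f dx` for all `f ∈ C_c^∞(ℝⁿ)` and all `k`.
(Signed measures are finite by definition.) -/
def HasFinitePerimeter {n : ℕ} (A : Set (Space n)) : Prop :=
  NullMeasurableSet A volume ∧
    ∃ D : Fin n → SignedMeasure (Space n),
      ∀ f : Space n → ℝ, ContDiff ℝ ∞ f → HasCompactSupport f → ∀ k : Fin n,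
        ∫ᵛ x, f x ∂<•(D k) = -∫ x in A, fderiv ℝ f x (EuclideanSpace.single k 1)

end LatticePhases

end

/-! Call a cell a defect if `u` agrees with no `v l` on the cube of side `M * h` around it. By (H2)
each defect forces a site of energy at least `C` nearby, so there are at most a constant times `ε ^
(1 - n)` defects (`defectLabels_card_le`). Since `M ≥ 2`, the cubes of two adjacent non-defect cells
overlap in a full period, hence carry the same phase (`mem_phaseLabels_iff_of_adjacent`). A phase
therefore changes only at faces of defect cells, and the total area of these faces is bounded.

Perimeter is measured through translations: a bound `|A ∆ (A - z)| ≤ P‖z‖` holds for every phase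
with `P` independent of `ε` (`shiftDiff_cellIndex_preimage_le`). This one estimate gives
compactness, as in Kolmogorov-Riesz (`exists_subseq_of_shiftDiff_le`), passes to the limit
(`shiftDiff_le_of_tendsto`), and yields finite perimeter by taking vague limits of difference
quotients (`hasFinitePerimeter_of_shiftDiff_le`).

The phases are disjoint and miss only the defect cells, whose volume is `O(ε)`. The limits thus
partition space up to a null set, which is then reassigned. -/

noncomputable section

namespace LatticePhases

/-! ### Cells, phases and the counting of defects -/

section Cells

variable {n m K : ℕ} {X : Set (Space m)}

/-- The label of the cell of side `s` which contains `x`. -/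
def cellIndex (s : ℝ) (x : Space n) : IntLattice n := fun k => ⌈x k / s - 1 / 2⌉

lemma cellIndex_eq_iff {s : ℝ} (hs : 0 < s) (x : Space n) (j : IntLattice n) :
    cellIndex s x = j ↔ ∀ k, s * j k - s / 2 < x k ∧ x k ≤ s * j k + s / 2 := by
  simp only [funext_iff, cellIndex, Int.ceil_eq_iff]
  refine forall_congr' fun k => ?_
  have h1 : x k = s * (x k / s) := by field_simp
  generalize x k / s = y at h1
  rw [h1]
  constructor
  · rintro ⟨h2, h3⟩
    constructor <;> nlinarith
  · rintro ⟨h2, h3⟩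
    constructor
    · by_contra! h
      nlinarith
    · by_contra! h
      nlinarith

lemma measurable_cellIndex (s : ℝ) : Measurable (cellIndex (n := n) s) := by
  unfold cellIndex
  fun_prop

lemma measurableSet_cellIndex_preimage (s : ℝ) (I : Set (IntLattice n)) :
    MeasurableSet (cellIndex s ⁻¹' I) :=
  measurable_cellIndex s I.to_countable.measurableSet

lemma smul_cube_eq {ε : ℝ} (hε : 0 < ε) {h : ℕ} (hh : 1 ≤ h) (j : IntLattice n) :
    ε • cube ((h : ℝ) • toSpace j) h = {x | cellIndex (ε * h) x = j} := by
  have hh' : (0 : ℝ) < h := by exact_mod_cast hh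
  ext x
  rw [Set.mem_smul_set_iff_inv_smul_mem₀ hε.ne', Set.mem_ofPred_eq,
    cellIndex_eq_iff (by positivity)]
  simp only [cube, toSpace, Set.mem_ofPred_eq, PiLp.smul_apply, smul_eq_mul]
  refine forall_congr' fun k => ?_
  rw [← mul_lt_mul_iff_right₀ hε, ← mul_le_mul_iff_right₀ hε, mul_inv_cancel_left₀ hε.ne']
  ring_nf

lemma phase_eq {ε : ℝ} (hε : 0 < ε) {h : ℕ} (hh : 1 ≤ h) (w u : Config n X) :
    phase h w ε u = cellIndex (ε * h) ⁻¹' phaseLabels h w u := by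
  ext x
  simp [phase, smul_cube_eq hε hh]

/-- Doubling clears the half side, so that membership becomes integer arithmetic. -/
lemma toSpace_mem_cube_iff (i a : IntLattice n) (N : ℕ) :
    toSpace i ∈ cube (toSpace a) N ↔ ∀ k, 2 * a k - N < 2 * i k ∧ 2 * i k ≤ 2 * a k + N := by
  simp only [cube, toSpace, Set.mem_ofPred_eq]
  refine forall_congr' fun k => ?_
  have h1 : (a k : ℝ) - N / 2 < i k ↔ ((2 * a k - N : ℤ) : ℝ) < (2 * i k : ℤ) := by
    push_cast
    constructor <;> intro h <;> linarith
  have h2 : (i k : ℝ) ≤ a k + N / 2 ↔ ((2 * i k : ℤ) : ℝ) ≤ (2 * a k + N : ℤ) := by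
    push_cast
    constructor <;> intro h <;> linarith
  rw [h1, h2, Int.cast_lt, Int.cast_le]

lemma toSpace_smul (h : ℕ) (j : IntLattice n) :
    toSpace (fun k => (h : ℤ) * j k) = (h : ℝ) • toSpace j := by
  ext k
  simp [toSpace]

lemma mem_phaseLabels_iff {h : ℕ} {w u : Config n X} {j : IntLattice n} :
    j ∈ phaseLabels h w u ↔ ∀ i : IntLattice n,
      (∀ k, 2 * (h * j k) - h < 2 * i k ∧ 2 * i k ≤ 2 * (h * j k) + h) → u i = w i := by
  simp only [phaseLabels, Set.mem_ofPred_eq, ← toSpace_smul, toSpace_mem_cube_iff]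

lemma IsPeriodic.add_single {h : ℕ} {v : Config n X} (hv : IsPeriodic h v) (k : Fin n) (z : ℤ)
    (j : IntLattice n) : v (j + Pi.single k (h * z)) = v j := by
  induction z using Int.induction_on generalizing j with
  | zero => simp
  | succ z ih =>
    rw [mul_add, mul_one, Pi.single_add, ← add_assoc, hv, ih]
  | pred z ih =>
    rw [← ih j, ← hv k (j + _), mul_sub, mul_one, add_assoc, ← Pi.single_add, sub_add_cancel]

lemma IsPeriodic.add_mul {h : ℕ} {v : Config n X} (hv : IsPeriodic h v) (z j : IntLattice n) :
    v (fun k => j k + h * z k) = v j := by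
  have key : ∀ s : Finset (Fin n), v (j + ∑ k ∈ s, Pi.single k (h * z k)) = v j := by
    intro s
    induction s using Finset.induction_on with
    | empty => simp
    | insert a s has ih =>
      rw [Finset.sum_insert has, add_comm (Pi.single _ _), ← add_assoc, hv.add_single, ih]
  rw [← key Finset.univ, Finset.univ_sum_single]
  rfl

/-- The box `(a, a + h]ⁿ` contains a representative of every class modulo `h`. -/
lemma IsPeriodic.eq_of_eqOn_box {h : ℕ} (hh : 1 ≤ h) {v w : Config n X} (hv : IsPeriodic h v)
    (hw : IsPeriodic h w) (a : IntLattice n)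
    (hvw : ∀ i : IntLattice n, (∀ k, a k < i k ∧ i k ≤ a k + h) → v i = w i) : v = w := by
  funext j
  -- The `- 1` matches a box open on the left: `j - a - 1` reduces to `[0, h)`, so `j` moves into
  -- `(a, a + h]`.
  rw [← hv.add_mul (fun k => -((j k - a k - 1) / h)) j,
    ← hw.add_mul (fun k => -((j k - a k - 1) / h)) j]
  apply hvw
  intro k
  have h1 := Int.emod_add_mul_ediv (j k - a k - 1) h
  have h2 := Int.emod_nonneg (j k - a k - 1) (b := h) (by omega)
  have h3 := Int.emod_lt_of_pos (j k - a k - 1) (b := h) (by omega)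
  rw [mul_neg]
  omega

lemma disjoint_phaseLabels {h : ℕ} (hh : 1 ≤ h) {v w : Config n X} (hv : IsPeriodic h v)
    (hw : IsPeriodic h w) (hvw : v ≠ w) (u : Config n X) :
    Disjoint (phaseLabels h v u) (phaseLabels h w u) := by
  rw [Set.disjoint_left]
  intro j h1 h2
  rw [mem_phaseLabels_iff] at h1 h2
  -- With this floor, the box consists of exactly the integer points of the cell, for either parity
  -- of `h`.
  refine hvw (hv.eq_of_eqOn_box hh hw (fun k => (2 * (h * j k) - h) / 2) fun i hi => ?_)
  have : ∀ k, 2 * (h * j k) - h < 2 * i k ∧ 2 * i k ≤ 2 * (h * j k) + h := fun k => by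
    have := hi k
    generalize (h : ℤ) * j k = y at *
    omega
  rw [← h1 i this, ← h2 i this]

/-- The labels of the cells around which `u` coincides with none of the functions `v l`. -/
def defectLabels (h M : ℕ) (v : Fin K → Config n X) (u : Config n X) : Set (IntLattice n) :=
  {j | ∀ l, ∃ i : IntLattice n,
    toSpace i ∈ cube (toSpace fun k => (h : ℤ) * j k) ((M : ℝ) * h) ∧ u i ≠ v l i}

lemma exists_phase_of_notMem_defectLabels {h M : ℕ} (hM : 2 ≤ M) {v : Fin K → Config n X}
    {u : Config n X} {j : IntLattice n} (hj : j ∉ defectLabels h M v u) :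
    ∃ l, ∀ i : IntLattice n, (∀ k, h * j k - h < i k ∧ i k ≤ h * j k + h) → u i = v l i := by
  simp only [defectLabels, Set.mem_ofPred_eq, not_forall, not_exists, not_and, not_not] at hj
  obtain ⟨l, hl⟩ := hj
  refine ⟨l, fun i hi => hl i ?_⟩
  have h1 : ((M : ℝ) * h) = ((M * h : ℕ) : ℝ) := by push_cast; rfl
  have h2 : 2 * h ≤ M * h := Nat.mul_le_mul_right _ hM
  rw [h1, toSpace_mem_cube_iff]
  intro k
  have := hi k
  generalize (h : ℤ) * j k = y at *
  generalize M * h = z at *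
  omega

lemma mem_phaseLabels_of_box {h : ℕ} {w u : Config n X} {j : IntLattice n}
    (hj : ∀ i : IntLattice n, (∀ k, h * j k - h < i k ∧ i k ≤ h * j k + h) → u i = w i) :
    j ∈ phaseLabels h w u := by
  rw [mem_phaseLabels_iff]
  intro i hi
  refine hj i fun k => ?_
  have := hi k
  generalize (h : ℤ) * j k = y at *
  omega

lemma exists_mem_phaseLabels {h M : ℕ} (hM : 2 ≤ M) {v : Fin K → Config n X}
    {u : Config n X} {j : IntLattice n} (hj : j ∉ defectLabels h M v u) :
    ∃ l, j ∈ phaseLabels h (v l) u :=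
  (exists_phase_of_notMem_defectLabels hM hj).imp fun _ => mem_phaseLabels_of_box

lemma mem_phaseLabels_iff_of_adjacent {h M : ℕ} (hh : 1 ≤ h) (hM : 2 ≤ M)
    {v : Fin K → Config n X} (hv : ∀ l, IsPeriodic h (v l)) (hv_inj : Function.Injective v)
    {u : Config n X} {j : IntLattice n} {d : Fin n} (hj : j ∉ defectLabels h M v u)
    (hj' : j + Pi.single d 1 ∉ defectLabels h M v u) (l : Fin K) :
    j ∈ phaseLabels h (v l) u ↔ j + Pi.single d 1 ∈ phaseLabels h (v l) u := by
  obtain ⟨a, ha⟩ := exists_phase_of_notMem_defectLabels hM hj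
  obtain ⟨b, hb⟩ := exists_phase_of_notMem_defectLabels hM hj'
  -- The two boxes of side `2h` share `(hj, hj + h]ⁿ`, a full period, on which `v a = u = v b`.
  have hab : a = b := by
    refine hv_inj ((hv a).eq_of_eqOn_box hh (hv b) (fun k => h * j k) fun i hi => ?_)
    rw [← ha i fun k => ⟨by have := hi k; omega, (hi k).2⟩, ← hb i fun k => ?_]
    have := hi k
    rw [Pi.add_apply, mul_add]
    rcases eq_or_ne k d with rfl | hk
    · rw [Pi.single_eq_same]
      omega
    · rw [Pi.single_eq_of_ne hk]
      omega
  subst hab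
  have ha' := mem_phaseLabels_of_box ha
  have hb' := mem_phaseLabels_of_box hb
  by_cases hla : l = a
  · subst hla
    exact iff_of_true ha' hb'
  · have := disjoint_phaseLabels hh (hv l) (hv a) (hv_inj.ne hla) u
    exact iff_of_false (fun h1 => Set.disjoint_left.1 this h1 ha')
      fun h1 => Set.disjoint_left.1 this h1 hb'

/-- The number of defects is controlled by the energy. -/
lemma defectLabels_card_le {φ : Config n X → ℝ} {h M M' : ℕ} (hh : 1 ≤ h)
    {v : Fin K → Config n X} {C : ℝ} (hC : 0 < C)
    (hcoer : ∀ (u : Config n X) (i : IntLattice n),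
      (∀ l, ∃ j : IntLattice n, toSpace j ∈ cube (toSpace i) ((M : ℝ) * h) ∧ u j ≠ v l j) →
      ∃ i' : IntLattice n, toSpace i' ∈ cube (toSpace i) ((M' : ℝ) * h) ∧ C ≤ φ (shiftBy i' u))
    {ε : ℝ} (hε : 0 < ε) (u : Config n X) (hu : energy φ ε u ≠ ⊤) :
    (defectLabels h M v u).Finite ∧ ((defectLabels h M v u).ncard : ℝ) * ε ^ (n - 1) ≤
      (2 * M' + 1) ^ n * (energy φ ε u).toReal / C := by
  have hc : ENNReal.ofReal (ε ^ (n - 1) * C) ≠ 0 := by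
    simp only [ne_eq, ENNReal.ofReal_eq_zero, not_le]
    positivity
  -- Chebyshev's inequality: finite energy leaves finitely many sites with `φ ≥ C`; they form `S`.
  obtain ⟨hf, hcard⟩ := ENNReal.finset_card_const_le_le_of_tsum_le hu le_rfl hc
  set S := hf.toFinset with hS
  have hcard' : (S.card : ℝ) * (ε ^ (n - 1) * C) ≤ (energy φ ε u).toReal := by
    rw [ENNReal.le_div_iff_mul_le (.inl hc) (.inl ENNReal.ofReal_ne_top)] at hcard
    have := ENNReal.toReal_mono hu hcard
    rwa [ENNReal.toReal_mul, ENNReal.toReal_natCast,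
      ENNReal.toReal_ofReal (by positivity)] at this
  have hsel : ∀ j ∈ defectLabels h M v u, ∃ i' ∈ S,
      ∀ k, 2 * (h * j k) - (M' * h : ℕ) < 2 * i' k ∧ 2 * i' k ≤ 2 * (h * j k) + (M' * h : ℕ) := by
    intro j hj
    obtain ⟨i', h1, h2⟩ := hcoer u _ hj
    have h3 : ((M' : ℝ) * h) = ((M' * h : ℕ) : ℝ) := by push_cast; rfl
    rw [h3, toSpace_mem_cube_iff] at h1
    refine ⟨i', ?_, h1⟩
    rw [hS, Set.Finite.mem_toFinset]
    exact ENNReal.ofReal_le_ofReal (by gcongr)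
  choose! g hgS hg using hsel
  let T : Finset (IntLattice n × IntLattice n) :=
    S ×ˢ Fintype.piFinset fun _ => Finset.Icc (-(M' : ℤ)) M'
  -- A defect is recovered from its chosen site and its offset from the site's block. Offsets lie in
  -- `[-M', M']ⁿ`, so a site serves at most `(2 * M' + 1) ^ n` defects.
  let f : IntLattice n → IntLattice n × IntLattice n := fun j => (g j, fun k => j k - g j k / h)
  have hmaps : Set.MapsTo f (defectLabels h M v u) (T : Set (IntLattice n × IntLattice n)) := by
    intro j hj
    simp only [T, f, Finset.mem_coe, Finset.mem_product, hgS j hj, Fintype.mem_piFinset,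
      Finset.mem_Icc, true_and]
    intro k
    obtain ⟨h1, h2⟩ := hg j hj k
    have h4 := Int.emod_add_mul_ediv (g j k) h
    have h5 := Int.emod_nonneg (g j k) (b := h) (by omega)
    have h6 := Int.emod_lt_of_pos (g j k) (b := h) (by omega)
    push_cast at h1 h2
    have hh' : (1 : ℤ) ≤ h := by exact_mod_cast hh
    constructor
    · by_contra! hcon
      nlinarith
    · by_contra! hcon
      nlinarith
  have hinj : Set.InjOn f (defectLabels h M v u) := by
    intro j _ j' _ hjj
    simp only [f, Prod.mk.injEq, funext_iff] at hjj
    funext k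
    have h1 := hjj.1 k
    have h2 := hjj.2 k
    rw [h1] at h2
    omega
  have hfin : (defectLabels h M v u).Finite := Set.Finite.of_injOn hmaps hinj T.finite_toSet
  refine ⟨hfin, ?_⟩
  have hT : (defectLabels h M v u).ncard ≤ S.card * (2 * M' + 1) ^ n := by
    calc (defectLabels h M v u).ncard ≤ (T : Set (IntLattice n × IntLattice n)).ncard :=
          Set.ncard_le_ncard_of_injOn f hmaps hinj T.finite_toSet
      _ = S.card * (2 * M' + 1) ^ n := by
          rw [Set.ncard_coe_finset, Finset.card_product, Fintype.card_piFinset_const, Int.card_Icc]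
          congr 2
          omega
  have hT' : ((defectLabels h M v u).ncard : ℝ) ≤ S.card * (2 * M' + 1) ^ n := by
    exact_mod_cast hT
  rw [le_div_iff₀ hC]
  calc ((defectLabels h M v u).ncard : ℝ) * ε ^ (n - 1) * C
      = ((defectLabels h M v u).ncard : ℝ) * (ε ^ (n - 1) * C) := by ring
    _ ≤ S.card * (2 * M' + 1) ^ n * (ε ^ (n - 1) * C) := by gcongr
    _ = (2 * M' + 1) ^ n * (S.card * (ε ^ (n - 1) * C)) := by ring
    _ ≤ _ := by gcongr

end Cells

/-! ### Translation estimates for unions of cells -/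

section Translations

variable {n : ℕ}

/-- The measure of the set of points at which `A` differs from its translate by `-z`. -/
def shiftDiff (A : Set (Space n)) (z : Space n) : ℝ≥0∞ :=
  volume (A ∆ ((fun x => x + z) ⁻¹' A))

lemma shiftDiff_add_le (A : Set (Space n)) (z w : Space n) :
    shiftDiff A (z + w) ≤ shiftDiff A z + shiftDiff A w := by
  have h1 : (fun x => x + (z + w)) ⁻¹' A = (fun x => x + z) ⁻¹' ((fun x => x + w) ⁻¹' A) := by
    ext x
    simp [add_assoc]
  refine (measure_symmDiff_le A ((fun x => x + z) ⁻¹' A) _).trans ?_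
  rw [h1, ← Set.preimage_symmDiff, measure_preimage_add_right]
  rfl

lemma shiftDiff_neg (A : Set (Space n)) (z : Space n) : shiftDiff A (-z) = shiftDiff A z := by
  have h1 : A = (fun x => x + -z) ⁻¹' ((fun x => x + z) ⁻¹' A) := by
    ext x
    simp
  unfold shiftDiff
  conv_lhs => enter [2, 1]; rw [h1]
  rw [← Set.preimage_symmDiff, measure_preimage_add_right, symmDiff_comm]

lemma shiftDiff_zero (A : Set (Space n)) : shiftDiff A 0 = 0 := by
  simp [shiftDiff]

lemma shiftDiff_nsmul_le (A : Set (Space n)) (N : ℕ) (z : Space n) :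
    shiftDiff A (N • z) ≤ N * shiftDiff A z := by
  induction N with
  | zero => simp [shiftDiff_zero]
  | succ N ih =>
    rw [succ_nsmul, Nat.cast_succ, add_mul, one_mul]
    exact (shiftDiff_add_le _ _ _).trans (by gcongr)

lemma shiftDiff_sum_le {ι : Type*} (A : Set (Space n)) (s : Finset ι) (z : ι → Space n) :
    shiftDiff A (∑ i ∈ s, z i) ≤ ∑ i ∈ s, shiftDiff A (z i) := by
  classical
  induction s using Finset.induction_on with
  | empty => simp [shiftDiff_zero]
  | insert a s has ih =>
    rw [Finset.sum_insert has, Finset.sum_insert has]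
    exact (shiftDiff_add_le _ _ _).trans (by gcongr)

lemma volume_box (a b : Fin n → ℝ) :
    volume {x : Space n | ∀ k, a k < x k ∧ x k ≤ b k} = ∏ k, ENNReal.ofReal (b k - a k) := by
  rw [← Real.volume_pi_Ioc, ← (EuclideanSpace.volume_preserving_symm_measurableEquiv_toLp
    (Fin n)).measure_preimage (MeasurableSet.univ_pi fun _ => measurableSet_Ioc).nullMeasurableSet]
  congr 1
  ext x
  simp [Set.mem_pi]

lemma volume_cellIndex_eq {s : ℝ} (hs : 0 < s) (j : IntLattice n) :
    volume {x : Space n | cellIndex s x = j} = ENNReal.ofReal (s ^ n) := by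
  simp_rw [cellIndex_eq_iff hs]
  rw [volume_box]
  simp [ENNReal.ofReal_pow hs.le]

/-- A shift by `t ≤ s` along `e_d` leaves the label `j` or turns it into `j + e_d`. Membership
changes only when `j` is a boundary label and the point lies within `t` of the upper face.
Finiteness is needed separately because `ncard` of an infinite set is `0`. -/
lemma shiftDiff_single_le_of_le {s : ℝ} (hs : 0 < s) {I : Set (IntLattice n)} {d : Fin n} {P : ℝ}
    (hfin : {j | ¬(j ∈ I ↔ j + Pi.single d 1 ∈ I)}.Finite)
    (hP : ({j | ¬(j ∈ I ↔ j + Pi.single d 1 ∈ I)}.ncard : ℝ) * s ^ (n - 1) ≤ P)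
    {t : ℝ} (ht : 0 ≤ t) (hts : t ≤ s) :
    shiftDiff (cellIndex s ⁻¹' I) (t • EuclideanSpace.single d 1) ≤ ENNReal.ofReal (P * t) := by
  set F := {j | ¬(j ∈ I ↔ j + Pi.single d 1 ∈ I)} with hF
  -- The slab of thickness `t` under the upper `d`-face of cell `j`.
  let B : IntLattice n → Set (Space n) := fun j => {x | ∀ k,
    (s * j k + s / 2 - if k = d then t else s) < x k ∧ x k ≤ s * j k + s / 2}
  have hB : ∀ j, volume (B j) = ENNReal.ofReal (t * s ^ (n - 1)) := by
    intro j
    simp only [B]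
    rw [volume_box, ← Finset.mul_prod_erase _ _ (Finset.mem_univ d), ENNReal.ofReal_mul ht,
      Finset.prod_congr rfl (g := fun _ => ENNReal.ofReal s)]
    · simp [ENNReal.ofReal_pow hs.le]
    · intro k hk
      simp [(Finset.mem_erase.1 hk).1]
  have hsub : (cellIndex s ⁻¹' I) ∆ ((fun x => x + t • EuclideanSpace.single d 1) ⁻¹'
      (cellIndex s ⁻¹' I)) ⊆ ⋃ j ∈ hfin.toFinset, B j := by
    intro x hx
    obtain ⟨j, hj⟩ : ∃ j, cellIndex s x = j := ⟨_, rfl⟩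
    have hx' : ¬(j ∈ I ↔ cellIndex s (x + t • EuclideanSpace.single d 1) ∈ I) := by
      rw [Set.mem_symmDiff] at hx
      simp only [Set.mem_preimage, hj] at hx
      tauto
    have hjx := (cellIndex_eq_iff hs x j).1 hj
    have hd : s * j d + s / 2 - t < x d := by
      by_contra! hcon
      refine hx' ?_
      rw [(cellIndex_eq_iff hs (x + t • EuclideanSpace.single d 1) j).2 fun k => ?_]
      have := hjx k
      rcases eq_or_ne k d with rfl | hk
      · simp only [PiLp.add_apply, PiLp.smul_apply, PiLp.single_apply, if_true, smul_eq_mul, mul_one]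
        constructor <;> linarith
      · simpa [hk] using this
    have hnext : cellIndex s (x + t • EuclideanSpace.single d 1) = j + Pi.single d 1 := by
      refine (cellIndex_eq_iff hs _ _).2 fun k => ?_
      have := hjx k
      rcases eq_or_ne k d with rfl | hk
      · simp only [PiLp.add_apply, PiLp.smul_apply, PiLp.single_apply, if_true, smul_eq_mul,
          mul_one, Pi.add_apply, Pi.single_eq_same, Int.cast_add, Int.cast_one]
        constructor <;> linarith
      · simpa [hk] using this
    rw [hnext] at hx'
    simp only [Set.mem_iUnion, Set.Finite.mem_toFinset, exists_prop]
    refine ⟨j, hx', fun k => ⟨?_, (hjx k).2⟩⟩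
    split_ifs with hk
    · rw [hk]
      exact hd
    · have := (hjx k).1
      linarith
  calc shiftDiff (cellIndex s ⁻¹' I) (t • EuclideanSpace.single d 1)
      ≤ volume (⋃ j ∈ hfin.toFinset, B j) := measure_mono hsub
    _ ≤ ∑ j ∈ hfin.toFinset, volume (B j) := measure_biUnion_finset_le _ _
    _ = ENNReal.ofReal (F.ncard * (t * s ^ (n - 1))) := by
        simp only [hB, Finset.sum_const, nsmul_eq_mul]
        rw [← Set.ncard_eq_toFinset_card _ hfin, ENNReal.ofReal_mul (Nat.cast_nonneg _),
          ENNReal.ofReal_natCast]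
    _ ≤ ENNReal.ofReal (P * t) := by
        apply ENNReal.ofReal_le_ofReal
        calc (F.ncard : ℝ) * (t * s ^ (n - 1)) = F.ncard * s ^ (n - 1) * t := by ring
          _ ≤ P * t := by gcongr

lemma shiftDiff_single_le {s : ℝ} (hs : 0 < s) {I : Set (IntLattice n)} {d : Fin n} {P : ℝ}
    (hfin : {j | ¬(j ∈ I ↔ j + Pi.single d 1 ∈ I)}.Finite)
    (hP : ({j | ¬(j ∈ I ↔ j + Pi.single d 1 ∈ I)}.ncard : ℝ) * s ^ (n - 1) ≤ P) (t : ℝ) :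
    shiftDiff (cellIndex s ⁻¹' I) (t • EuclideanSpace.single d 1) ≤
      ENNReal.ofReal (P * |t|) := by
  wlog ht : 0 < t generalizing t
  · rcases (not_lt.1 ht).eq_or_lt with rfl | ht
    · simp [shiftDiff_zero]
    · have := this (-t) (by linarith)
      rwa [neg_smul, shiftDiff_neg, abs_neg] at this
  -- A long translation is cut into `N` equal steps of length at most `s`; subadditivity keeps the
  -- bound linear in `t`.
  have hN : 0 < ⌈t / s⌉₊ := Nat.ceil_pos.2 (by positivity)
  set N := ⌈t / s⌉₊
  have hN' : (0 : ℝ) < N := by exact_mod_cast hN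
  have hNs : t / N ≤ s := by
    have := Nat.le_ceil (t / s)
    rw [div_le_iff₀ hs] at this
    rw [div_le_iff₀ hN', mul_comm]
    exact this
  have h1 : t • EuclideanSpace.single d (1 : ℝ) = N • ((t / N) • EuclideanSpace.single d (1 : ℝ)) := by
    rw [← Nat.cast_smul_eq_nsmul ℝ, smul_smul, mul_div_cancel₀ _ hN'.ne']
  rw [h1]
  refine (shiftDiff_nsmul_le _ _ _).trans ?_
  calc (N : ℝ≥0∞) * shiftDiff (cellIndex s ⁻¹' I) ((t / N) • EuclideanSpace.single d 1)
      ≤ N * ENNReal.ofReal (P * (t / N)) := by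
        gcongr
        exact shiftDiff_single_le_of_le hs hfin hP (by positivity) hNs
    _ = ENNReal.ofReal (P * |t|) := by
        rw [← ENNReal.ofReal_natCast, ← ENNReal.ofReal_mul hN'.le, abs_of_pos ht]
        congr 1
        field_simp

/-- A union of cells of side `s` with few boundary faces is moved little by translations. -/
lemma shiftDiff_cellIndex_preimage_le {s : ℝ} (hs : 0 < s) {I : Set (IntLattice n)} {P : ℝ}
    (hI : ∀ d : Fin n, {j | ¬(j ∈ I ↔ j + Pi.single d 1 ∈ I)}.Finite ∧
      ({j | ¬(j ∈ I ↔ j + Pi.single d 1 ∈ I)}.ncard : ℝ) * s ^ (n - 1) ≤ P)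
    (hP : 0 ≤ P) (z : Space n) :
    shiftDiff (cellIndex s ⁻¹' I) z ≤ ENNReal.ofReal (n * P * ‖z‖) := by
  have hz : z = ∑ d, z d • EuclideanSpace.single d (1 : ℝ) := by
    ext k
    simp [Pi.single_apply]
  conv_lhs => rw [hz]
  refine (shiftDiff_sum_le _ _ _).trans ?_
  calc ∑ d, shiftDiff (cellIndex s ⁻¹' I) (z d • EuclideanSpace.single d 1)
      ≤ ∑ _d : Fin n, ENNReal.ofReal (P * ‖z‖) := by
        refine Finset.sum_le_sum fun d _ => ?_
        refine (shiftDiff_single_le hs (hI d).1 (hI d).2 (z d)).trans ?_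
        gcongr
        exact PiLp.norm_apply_le z d
    _ = ENNReal.ofReal (n * P * ‖z‖) := by
        rw [Finset.sum_const, Finset.card_univ, Fintype.card_fin, nsmul_eq_mul, mul_assoc,
          ENNReal.ofReal_mul (Nat.cast_nonneg n), ENNReal.ofReal_natCast]

end Translations

/-! ### Vague limits of measures -/

section VagueCompactness

open CompactlySupported

/-- Vague compactness of sets of measures with bounded mass. -/
lemma exists_vague_limit {E : Type*} [TopologicalSpace E] [T2Space E] [LocallyCompactSpace E]
    [MeasurableSpace E] [BorelSpace E] {ι : Type*} (l : Ultrafilter ι) (μ : ι → Measure E)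
    {C : ℝ} (hC : 0 ≤ C) (hμ : ∀ i, μ i Set.univ ≤ ENNReal.ofReal C) :
    ∃ ν : Measure E, IsFiniteMeasure ν ∧
      ∀ g : C_c(E, ℝ), Tendsto (fun i => ∫ x, g x ∂μ i) l (𝓝 (∫ x, g x ∂ν)) := by
  have hfin : ∀ i, IsFiniteMeasure (μ i) := fun i => ⟨(hμ i).trans_lt ENNReal.ofReal_lt_top⟩
  have hmass : ∀ i, (μ i).real Set.univ ≤ C := fun i =>
    ENNReal.toReal_le_of_le_ofReal hC (hμ i)
  have hint : ∀ (g : C_c(E, ℝ)) i, Integrable g (μ i) := fun g i =>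
    g.continuous.integrable_of_hasCompactSupport g.hasCompactSupport
  -- For each `g` the integrals stay in a compact interval, so they converge along the ultrafilter.
  -- The limits form a positive functional, to which Riesz-Markov applies.
  have L (g : C_c(E, ℝ)) : ∃ x, Tendsto (fun i => ∫ x, g x ∂μ i) l (𝓝 x) := by
    obtain ⟨b, hb⟩ := g.continuous.bounded_above_of_compact_support g.hasCompactSupport
    have hmem : ∀ i, ∫ x, g x ∂μ i ∈ Metric.closedBall (0 : ℝ) (max b 0 * C) := fun i => by
      rw [mem_closedBall_zero_iff]
      refine (norm_integral_le_of_norm_le_const (Eventually.of_forall fun x =>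
        (hb x).trans (le_max_left b 0))).trans ?_
      gcongr
      exact hmass i
    have := (isCompact_closedBall (0 : ℝ) (max b 0 * C)).ultrafilter_le_nhds'
      (l.map fun i => ∫ x, g x ∂μ i) (Filter.mem_map.2 (Filter.univ_mem' hmem))
    obtain ⟨x, -, hx⟩ := this
    exact ⟨x, hx⟩
  choose Λ hΛ using L
  let Λ' : C_c(E, ℝ) →ₚ[ℝ] ℝ :=
  { toFun := Λ
    map_add' g g' := by
      refine tendsto_nhds_unique (hΛ (g + g')) (((hΛ g).add (hΛ g')).congr fun i => ?_)
      exact (integral_add (hint g i) (hint g' i)).symm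
    map_smul' c g := by
      refine tendsto_nhds_unique (hΛ (c • g)) (((hΛ g).const_smul c).congr fun i => ?_)
      exact (integral_smul c g).symm
    monotone' g g' hgg' :=
      le_of_tendsto_of_tendsto' (hΛ g) (hΛ g') fun i => integral_mono (hint g i) (hint g' i) hgg' }
  refine ⟨RealRMK.rieszMeasure Λ', ⟨?_⟩, fun g => ?_⟩
  · refine lt_of_le_of_lt ?_ (ENNReal.ofReal_lt_top (r := C))
    rw [isOpen_univ.measure_eq_iSup_isCompact]
    refine iSup₂_le fun K _ => iSup_le fun hK => ?_
    obtain ⟨f, hf1, hf2, hf3⟩ :=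
      exists_continuousMap_one_of_isCompact_subset_isOpen hK isOpen_univ (Set.subset_univ K)
    let g : C_c(E, ℝ) := ⟨f, hf2⟩
    refine (RealRMK.rieszMeasure_le_of_eq_one Λ' (f := g) (fun x => (hf3.2 x).1) hK
      fun x hx => hf1 hx).trans ?_
    apply ENNReal.ofReal_le_ofReal
    refine le_of_tendsto' (hΛ g) fun i => ?_
    calc ∫ x, g x ∂μ i ≤ ∫ _, (1 : ℝ) ∂μ i :=
          integral_mono (hint g i) (integrable_const 1) fun x => (hf3.2 x).2
      _ ≤ C := by simpa using hmass i
  · rw [RealRMK.integral_rieszMeasure]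
    exact hΛ g

end VagueCompactness

/-! ### From translation bounds to finite perimeter -/

section FinitePerimeter

variable {n : ℕ}

/-- Dominated convergence: the quotients are bounded by the Lipschitz constant of `f` and vanish at
distance more than `1` from its support. -/
lemma tendsto_setIntegral_difference_quotient (A : Set (Space n)) {f : Space n → ℝ}
    (hf : ContDiff ℝ ∞ f) (hfc : HasCompactSupport f) (e : Space n) (he : ‖e‖ ≤ 1) :
    Tendsto (fun i : ℕ => ∫ x in A, ((1 : ℝ) / (i + 1))⁻¹ * (f (x + ((1 : ℝ) / (i + 1)) • e) - f x))
      atTop (𝓝 (∫ x in A, fderiv ℝ f x e)) := by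
  obtain ⟨C, hC⟩ := ContDiff.lipschitzWith_of_hasCompactSupport hfc hf (by simp)
  set S := Metric.cthickening 1 (tsupport f)
  have hS : IsCompact S := hfc.isCompact.cthickening
  refine tendsto_integral_of_dominated_convergence (S.indicator fun _ => (C : ℝ)) ?_ ?_ ?_ ?_
  · intro i
    have := hf.continuous
    exact (by fun_prop : Continuous fun x => ((1 : ℝ) / (i + 1))⁻¹ *
      (f (x + ((1 : ℝ) / (i + 1)) • e) - f x)).aestronglyMeasurable
  · refine Integrable.restrict ?_
    rw [integrable_indicator_iff hS.measurableSet]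
    exact integrableOn_const hS.measure_lt_top.ne
  · intro i
    refine Eventually.of_forall fun x => ?_
    have ht : (0 : ℝ) < 1 / (i + 1) := by positivity
    have ht1 : (1 : ℝ) / (i + 1) ≤ 1 := by
      rw [div_le_one (by positivity)]
      linarith [(Nat.cast_nonneg i : (0 : ℝ) ≤ i)]
    generalize (1 : ℝ) / (i + 1) = t at ht ht1
    have hte : ‖t • e‖ ≤ t := by
      rw [norm_smul, Real.norm_of_nonneg ht.le]
      exact mul_le_of_le_one_right ht.le he
    by_cases hx : x ∈ S
    · rw [Set.indicator_of_mem hx, norm_mul, norm_inv, Real.norm_of_nonneg ht.le,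
        inv_mul_le_iff₀ ht]
      have := hC.dist_le_mul (x + t • e) x
      rw [dist_eq_norm, dist_eq_norm, add_sub_cancel_left] at this
      refine this.trans ?_
      rw [mul_comm]
      gcongr
    · have h1 : f x = 0 := image_eq_zero_of_notMem_tsupport fun h =>
        hx (Metric.self_subset_cthickening _ h)
      have h2 : f (x + t • e) = 0 := image_eq_zero_of_notMem_tsupport fun h =>
        hx (Metric.mem_cthickening_of_dist_le x _ _ _ h (by
          rw [dist_eq_norm, sub_add_cancel_left, norm_neg]
          exact hte.trans ht1))
      simp [h1, h2, Set.indicator_of_notMem hx]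
  · refine Eventually.of_forall fun x => ?_
    have h1 := (hf.differentiable (by simp) x).hasFDerivAt.hasLineDerivAt e
    have h2 : Tendsto (fun i : ℕ => (1 : ℝ) / (i + 1)) atTop (𝓝[≠] 0) :=
      tendsto_nhdsWithin_iff.2 ⟨tendsto_one_div_add_atTop_nhds_zero_nat,
        Eventually.of_forall fun i => by
          simp only [Set.mem_compl_iff, Set.mem_singleton_iff]
          positivity⟩
    exact h1.tendsto_slope_zero.comp h2

/-- The preimage is `A + z`. After a change of variables the contributions of `A ∩ (A + z)` cancel.
-/
lemma setIntegral_difference {A : Set (Space n)} (hA : MeasurableSet A) {f : Space n → ℝ}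
    (hf : Integrable f) (z : Space n) :
    ∫ x in A, (f (x + z) - f x) =
      (∫ x in ((fun x => x + -z) ⁻¹' A) \ A, f x) -
        ∫ x in A \ ((fun x => x + -z) ⁻¹' A), f x := by
  set A' := (fun x => x + -z) ⁻¹' A with hA'
  have hA'm : MeasurableSet A' := (measurable_add_const (-z)) hA
  have h1 : ∫ x in A, f (x + z) = ∫ x in A', f x := by
    rw [← (measurePreserving_add_right volume z).setIntegral_preimage_emb
      (measurableEmbedding_addRight z) f A']
    congr 2
    ext x
    simp [hA']
  rw [integral_sub (hf.comp_add_right z).integrableOn hf.integrableOn, h1,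
    ← integral_inter_add_sdiff hA hf.integrableOn (s := A'),
    ← integral_inter_add_sdiff hA'm hf.integrableOn (s := A), Set.inter_comm A A']
  ring

/-- A set which is moved by at most a multiple of the length of the translation has finite
perimeter. -/
theorem hasFinitePerimeter_of_shiftDiff_le {A : Set (Space n)} (hA : MeasurableSet A) {P : ℝ}
    (hP : 0 ≤ P) (hAP : ∀ z, shiftDiff A z ≤ ENNReal.ofReal (P * ‖z‖)) :
    HasFinitePerimeter A := by
  refine ⟨hA.nullMeasurableSet, ?_⟩
  suffices h : ∀ k : Fin n, ∃ D : SignedMeasure (Space n), ∀ f : Space n → ℝ, ContDiff ℝ ∞ f →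
      HasCompactSupport f →
        ∫ᵛ x, f x ∂<•D = -∫ x in A, fderiv ℝ f x (EuclideanSpace.single k 1) by
    choose D hD using h
    exact ⟨D, fun f hf hfc k => hD k f hf hfc⟩
  intro k
  set e : Space n := EuclideanSpace.single k 1
  have he : ‖e‖ = 1 := by simp [e]
  let t : ℕ → ℝ := fun i => 1 / (i + 1)
  have ht : ∀ i, 0 < t i := fun i => by positivity
  let A' : ℕ → Set (Space n) := fun i => (fun x => x + -(t i • e)) ⁻¹' A
  -- The factor `1 / t` is exactly compensated by the linear bound on `shiftDiff`.
  have hmass : ∀ i (S : Set (Space n)), S ⊆ A ∆ A' i →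
      (ENNReal.ofReal (t i)⁻¹ • volume.restrict S) Set.univ ≤ ENNReal.ofReal P := by
    intro i S hS
    have h1 : volume S ≤ ENNReal.ofReal (P * t i) := by
      refine (measure_mono hS).trans ((hAP _).trans_eq ?_)
      rw [norm_neg, norm_smul, he, Real.norm_of_nonneg (ht i).le, mul_one]
    rw [Measure.smul_apply, Measure.restrict_apply_univ, smul_eq_mul]
    calc ENNReal.ofReal (t i)⁻¹ * volume S
        ≤ ENNReal.ofReal (t i)⁻¹ * ENNReal.ofReal (P * t i) := by gcongr
      _ = ENNReal.ofReal P := by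
        rw [← ENNReal.ofReal_mul (inv_nonneg.2 (ht i).le)]
        congr 1
        field_simp [(ht i).ne']
  obtain ⟨μ, hμf, hμ⟩ := exists_vague_limit (hyperfilter ℕ)
    (fun i => ENNReal.ofReal (t i)⁻¹ • volume.restrict (A \ A' i)) hP
    fun i => hmass i _ Set.subset_union_left
  obtain ⟨ν, hνf, hν⟩ := exists_vague_limit (hyperfilter ℕ)
    (fun i => ENNReal.ofReal (t i)⁻¹ • volume.restrict (A' i \ A)) hP
    fun i => hmass i _ Set.subset_union_right
  -- The quotients over `A` tend to `∫ f dν - ∫ f dμ`; the minus sign of integration by parts gives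
  -- `μ - ν`.
  refine ⟨μ.toSignedMeasure - ν.toSignedMeasure, fun f hf hfc => ?_⟩
  have hfμ : Integrable f μ := hf.continuous.integrable_of_hasCompactSupport hfc
  have hfν : Integrable f ν := hf.continuous.integrable_of_hasCompactSupport hfc
  have hfv : Integrable f := hf.continuous.integrable_of_hasCompactSupport hfc
  rw [VectorMeasure.integral_sub_vectorMeasure
    (by simpa [VectorMeasure.Integrable] using hfμ) (by simpa [VectorMeasure.Integrable] using hfν),
    VectorMeasure.integral_toSignedMeasure, VectorMeasure.integral_toSignedMeasure]
  have h1 := (hμ ⟨⟨f, hf.continuous⟩, hfc⟩).sub (hν ⟨⟨f, hf.continuous⟩, hfc⟩)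
  have h2 := ((tendsto_setIntegral_difference_quotient A hf hfc e he.le).neg).mono_left
    (Nat.hyperfilter_le_atTop)
  refine tendsto_nhds_unique (h1.congr fun i => ?_) h2
  have h3 := setIntegral_difference hA hfv (t i • e)
  simp only [CompactlySupportedContinuousMap.coe_mk, ContinuousMap.coe_mk, integral_smul_measure,
    ENNReal.toReal_ofReal (inv_nonneg.2 (ht i).le), smul_eq_mul]
  rw [integral_const_mul]
  change _ = -((t i)⁻¹ * ∫ x in A, (f (x + t i • e) - f x))
  rw [h3, mul_sub, neg_sub]

end FinitePerimeter

/-! ### Approximation by unions of cells -/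

section Averaging

variable {n : ℕ}

lemma norm_le_of_forall_abs_le {x : Space n} {r : ℝ} (h : ∀ k, |x k| ≤ r) : ‖x‖ ≤ n * r := by
  have hx : x = ∑ d, x d • EuclideanSpace.single d (1 : ℝ) := by
    ext k
    simp [Pi.single_apply]
  rw [hx]
  refine (norm_sum_le _ _).trans ?_
  calc ∑ d, ‖x d • EuclideanSpace.single d (1 : ℝ)‖ ≤ ∑ _d : Fin n, r := by
        refine Finset.sum_le_sum fun d _ => ?_
        simpa [norm_smul] using h d
    _ = n * r := by simp

/-- A set which is moved little by translations is close to a union of cells of side `η`. -/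
lemma exists_cellIndex_preimage_near {E : Set (Space n)} (hE : MeasurableSet E) {P : ℝ}
    (hP : 0 ≤ P) (hEP : ∀ z, shiftDiff E z ≤ ENNReal.ofReal (P * ‖z‖)) {η : ℝ} (hη : 0 < η) :
    ∃ I : Set (IntLattice n),
      volume (E ∆ (cellIndex η ⁻¹' I)) ≤ ENNReal.ofReal (2 ^ n * (P * (n * η))) := by
  -- `p x` is the centre of the cell of `x`. For fixed `z`, the set `{x | p x + z ∈ E}` is a union
  -- of cells; a good `z` is found by averaging over `Q`.
  let p : Space n → Space n := fun x => η • toSpace (cellIndex η x)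
  have hp : Measurable p := by
    have h1 : Measurable fun j : IntLattice n => (η • toSpace j : Space n) := measurable_of_countable _
    exact h1.comp (measurable_cellIndex η)
  let Q : Set (Space n) := {z | cellIndex η z = 0}
  let D : Set (Space n) := {z | ∀ k, -η < z k ∧ z k ≤ η}
  have hQm : MeasurableSet Q := measurableSet_cellIndex_preimage η {0}
  have hDm : MeasurableSet D := by
    simp only [D, Set.ofPred_forall]
    refine MeasurableSet.iInter fun k => ?_
    have hk : Measurable fun z : Space n => z k := by fun_prop
    exact (measurableSet_lt measurable_const hk).inter (measurableSet_le hk measurable_const)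
  have hQv : volume Q = ENNReal.ofReal (η ^ n) := volume_cellIndex_eq hη 0
  have hDv : volume D = ENNReal.ofReal (2 ^ n * η ^ n) := by
    simp only [D]
    rw [volume_box (fun _ => -η) (fun _ => η)]
    simp only [Finset.prod_const, Finset.card_univ, Fintype.card_fin]
    rw [← ENNReal.ofReal_pow (by linarith), ← mul_pow]
    ring_nf
  have hmemQ : ∀ z, z ∈ Q ↔ ∀ k, -(η / 2) < z k ∧ z k ≤ η / 2 := fun z => by
    simp only [Q, Set.mem_ofPred_eq, cellIndex_eq_iff hη]
    simp
  have hpQ : ∀ x k, -(η / 2) < x k - p x k ∧ x k - p x k ≤ η / 2 := fun x k => by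
    have := (cellIndex_eq_iff hη x _).1 rfl k
    simp only [p, toSpace, PiLp.smul_apply, smul_eq_mul]
    constructor <;> linarith
  let T₁ : Set (Space n × Space n) := {q | q.2 ∈ Q} ∩ ((Prod.fst ⁻¹' E) ∆ ((fun q => p q.1 + q.2) ⁻¹' E))
  let T₂ : Set (Space n × Space n) := {q | q.2 ∈ D} ∩ ((Prod.fst ⁻¹' E) ∆ ((fun q => q.1 + q.2) ⁻¹' E))
  have hT₁ : MeasurableSet T₁ :=
    (measurable_snd hQm).inter ((measurable_fst hE).symmDiff
      (((hp.comp measurable_fst).add measurable_snd) hE))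
  have hT₂ : MeasurableSet T₂ :=
    (measurable_snd hDm).inter ((measurable_fst hE).symmDiff
      ((measurable_fst.add measurable_snd) hE))
  -- Substituting `z = ζ + (x - p x)` turns `p x + z` into `x + ζ`, with `ζ` in the doubled cube
  -- `D`.
  have hle : (volume.prod volume) T₁ ≤ (volume.prod volume) T₂ := by
    rw [Measure.prod_apply hT₁, Measure.prod_apply hT₂]
    refine lintegral_mono fun x => ?_
    rw [← measure_preimage_add_right volume (x - p x) (Prod.mk x ⁻¹' T₁)]
    refine measure_mono fun ζ hζ => ?_
    obtain ⟨h1, h2⟩ := hζ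
    refine ⟨fun k => ?_, ?_⟩
    · have h3 := (hmemQ _).1 h1 k
      have h4 := hpQ x k
      simp only [PiLp.add_apply, PiLp.sub_apply] at h3
      constructor <;> linarith
    · have h3 : p x + (ζ + (x - p x)) = x + ζ := by abel
      simpa only [Set.mem_symmDiff, Set.mem_preimage, h3] using h2
  have hT₂v : (volume.prod volume) T₂ ≤ ENNReal.ofReal (P * (n * η)) * volume D := by
    rw [Measure.prod_apply_symm hT₂, ← setLIntegral_const, ← lintegral_indicator hDm]
    refine lintegral_mono fun ζ => ?_
    by_cases hζ : ζ ∈ D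
    · rw [Set.indicator_of_mem hζ]
      refine (measure_mono (t := E ∆ ((fun x => x + ζ) ⁻¹' E)) fun x hx => hx.2).trans
        ((hEP ζ).trans ?_)
      gcongr
      exact norm_le_of_forall_abs_le fun k => abs_le.2 ⟨(hζ k).1.le, (hζ k).2⟩
    · rw [Set.indicator_of_notMem hζ]
      refine (measure_mono (t := ∅) fun x hx => hζ hx.1).trans (by simp)
  have hT₁v : (volume.prod volume) T₁ = ∫⁻ z in Q, volume ((fun x => (x, z)) ⁻¹' T₁) := by
    rw [Measure.prod_apply_symm hT₁, ← lintegral_indicator hQm]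
    refine lintegral_congr fun z => ?_
    by_cases hz : z ∈ Q
    · rw [Set.indicator_of_mem hz]
    · rw [Set.indicator_of_notMem hz]
      refine le_antisymm ((measure_mono (t := ∅) fun x hx => hz hx.1).trans (by simp)) zero_le
  have hQ0 : volume Q ≠ 0 := by
    rw [hQv]
    simp only [ne_eq, ENNReal.ofReal_eq_zero, not_le]
    positivity
  -- Some `z` does no worse than the mean; dividing by `|Q| = η ^ n` leaves the factor `2 ^ n` from
  -- `|D|`.
  obtain ⟨z, hz, hzle⟩ := exists_le_setLAverage (μ := volume) (s := Q) hQ0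
    (by rw [hQv]; exact ENNReal.ofReal_ne_top)
    (f := fun z => volume ((fun x => (x, z)) ⁻¹' T₁)) (measurable_measure_prodMk_right hT₁).aemeasurable
  refine ⟨{j | η • toSpace j + z ∈ E}, ?_⟩
  have hset : E ∆ (cellIndex η ⁻¹' {j | η • toSpace j + z ∈ E}) = (fun x => (x, z)) ⁻¹' T₁ := by
    ext x
    exact ⟨fun h => ⟨hz, h⟩, fun h => h.2⟩
  rw [hset]
  refine hzle.trans ?_
  rw [setLAverage_eq, ← hT₁v]
  refine ENNReal.div_le_of_le_mul ((hle.trans hT₂v).trans_eq ?_)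
  rw [hQv, hDv, ← ENNReal.ofReal_mul (by positivity), ← ENNReal.ofReal_mul (by positivity)]
  congr 1
  ring

lemma finite_image_cellIndex {η : ℝ} (hη : 0 < η) {S : Set (Space n)}
    (hS : Bornology.IsBounded S) : (cellIndex η '' S).Finite := by
  obtain ⟨R, hR⟩ := hS.exists_norm_le
  refine (Set.finite_Icc (fun _ : Fin n => ⌈-R / η - 1 / 2⌉) fun _ => ⌈R / η - 1 / 2⌉).subset ?_
  rintro _ ⟨x, hx, rfl⟩
  have h1 : ∀ k, |x k| ≤ R := fun k => (PiLp.norm_apply_le x k).trans (hR x hx)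
  refine ⟨fun k => Int.ceil_mono ?_, fun k => Int.ceil_mono ?_⟩
  · have := (abs_le.1 (h1 k)).1
    gcongr
  · have := (abs_le.1 (h1 k)).2
    gcongr

end Averaging

/-! ### Compactness and lower semicontinuity -/

section Compactness

variable {n : ℕ}

/-- The union of the cells of side `η` with labels in `I`, as a measured set. -/
def cellUnion (μ : Measure (Space n)) (η : ℝ) (I : Set (IntLattice n)) : MeasuredSets μ :=
  ⟨cellIndex η ⁻¹' I, measurableSet_cellIndex_preimage η I⟩

/-- Sets which are uniformly little moved by translations form a totally bounded family with
respect to a finite measure. -/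
lemma totallyBounded_setOfPred_shiftDiff_le (μ : Measure (Space n)) [IsFiniteMeasure μ]
    (hμ : μ ≤ volume) {P : ℝ} (hP : 0 ≤ P) :
    TotallyBounded {E : MeasuredSets μ | ∀ z, shiftDiff (E : Set (Space n)) z ≤ ENNReal.ofReal (P * ‖z‖)} := by
  rw [Metric.totallyBounded_iff]
  intro δ hδ
  obtain ⟨S, -, hSc, hS⟩ := MeasurableSet.univ.exists_isCompact_sdiff_lt (measure_ne_top μ _)
    (ENNReal.ofReal_pos.2 (half_pos hδ)).ne'
  -- Half of `δ` pays for the approximation by cells, half for the mass outside `S`; the `+ 1` keeps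
  -- the denominator positive when `P * n = 0`.
  let η : ℝ := δ / 2 / (2 ^ n * (P * n) + 1)
  have hη : 0 < η := by positivity
  have hηδ : 2 ^ n * (P * (n * η)) ≤ δ / 2 := by
    calc 2 ^ n * (P * (n * η)) ≤ (2 ^ n * (P * n) + 1) * η := by nlinarith
      _ = δ / 2 := by simp only [η]; field_simp
  have hJ := finite_image_cellIndex hη hSc.isBounded
  set J := cellIndex η '' S
  refine ⟨cellUnion μ η '' 𝒫 J, hJ.finite_subsets.image _, fun E hE => ?_⟩
  obtain ⟨I, hI⟩ := exists_cellIndex_preimage_near E.2 hP hE hη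
  refine Set.mem_biUnion (Set.mem_image_of_mem _ (Set.inter_subset_right (s := I))) ?_
  rw [Metric.mem_ball, MeasuredSets.dist_def, ← ENNReal.toReal_ofReal hδ.le, measureReal_def,
    ENNReal.toReal_lt_toReal (measure_ne_top _ _) ENNReal.ofReal_ne_top]
  have hsub : (E : Set (Space n)) ∆ (cellIndex η ⁻¹' (I ∩ J)) ⊆
      (E.1 ∆ (cellIndex η ⁻¹' I)) ∪ (Set.univ \ S) := by
    intro x hx
    by_cases hxS : x ∈ S
    · left
      have hxJ : cellIndex η x ∈ J := Set.mem_image_of_mem _ hxS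
      simp only [Set.mem_symmDiff, Set.mem_preimage, Set.mem_inter_iff, hxJ, and_true] at hx ⊢
      exact hx
    · right
      exact ⟨trivial, hxS⟩
  calc μ ((E : Set (Space n)) ∆ (cellIndex η ⁻¹' (I ∩ J)))
      ≤ μ (E.1 ∆ (cellIndex η ⁻¹' I)) + μ (Set.univ \ S) :=
        (measure_mono hsub).trans (measure_union_le _ _)
    _ < ENNReal.ofReal (δ / 2) + ENNReal.ofReal (δ / 2) := by
        refine ENNReal.add_lt_add_of_le_of_lt (measure_ne_top _ _) ?_ hS
        exact (hμ _).trans (hI.trans (ENNReal.ofReal_le_ofReal hηδ))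
    _ = ENNReal.ofReal δ := by
        rw [← ENNReal.ofReal_add (by positivity) (by positivity), add_halves]

/-- The indicator function of a measurable set, as an element of `L¹`. -/
def MeasuredSets.toL1 {α : Type*} [MeasurableSpace α] {μ : Measure α} [IsFiniteMeasure μ]
    (E : MeasuredSets μ) : Lp ℝ 1 μ :=
  indicatorConstLp 1 E.2 (measure_ne_top μ _) 1

/-- In the complete space `Lp` total boundedness gives convergent subsequences, whose limits are a
priori only functions. -/
lemma MeasuredSets.isometry_toL1 {α : Type*} [MeasurableSpace α] {μ : Measure α}
    [IsFiniteMeasure μ] : Isometry (MeasuredSets.toL1 (μ := μ)) := by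
  refine Isometry.of_dist_eq fun E F => ?_
  rw [MeasuredSets.toL1, MeasuredSets.toL1, dist_indicatorConstLp_eq_norm,
    norm_indicatorConstLp one_ne_zero ENNReal.one_ne_top, MeasuredSets.dist_def]
  simp
  rfl

/-- With `A = {g > 1/2}`, the indicator of `E k` differs from `g` by at least `1/2` wherever `E k`
and `A` disagree, so convergence in measure suffices. -/
lemma exists_limit_set_of_tendsto_toL1 {α : Type*} [MeasurableSpace α] {μ : Measure α}
    [IsFiniteMeasure μ] {E : ℕ → MeasuredSets μ} {g : Lp ℝ 1 μ}
    (hg : Tendsto (fun k => MeasuredSets.toL1 (E k)) atTop (𝓝 g)) :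
    ∃ A : Set α, MeasurableSet A ∧ Tendsto (fun k => μ ((E k : Set α) ∆ A)) atTop (𝓝 0) := by
  refine ⟨{x | 1 / 2 < g x}, measurableSet_lt measurable_const
    (Lp.stronglyMeasurable g).measurable, ?_⟩
  have h := tendstoInMeasure_of_tendsto_Lp hg (ENNReal.ofReal (1 / 2)) (by simp)
  refine tendsto_of_tendsto_of_tendsto_of_le_of_le tendsto_const_nhds h (fun _ => zero_le) fun k => ?_
  refine measure_mono_ae ?_
  filter_upwards [indicatorConstLp_coeFn (p := 1) (hs := (E k).2) (hμs := measure_ne_top μ _)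
    (c := (1 : ℝ))] with x hx hxk
  change x ∈ (E k).1 ∆ _ at hxk
  change ENNReal.ofReal (1 / 2) ≤ edist (MeasuredSets.toL1 (E k) x) (g x)
  rw [edist_dist]
  apply ENNReal.ofReal_le_ofReal
  rw [MeasuredSets.toL1, hx, Real.dist_eq]
  rcases hxk with ⟨h1, h2⟩ | ⟨h1, h2⟩
  · rw [Set.indicator_of_mem h1]
    have h2 : g x ≤ 1 / 2 := not_lt.1 h2
    exact (by linarith : (1 : ℝ) / 2 ≤ 1 - g x).trans (le_abs_self _)
  · rw [Set.indicator_of_notMem h2]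
    have h1 : 1 / 2 < g x := h1
    rw [zero_sub, abs_neg]
    exact h1.le.trans (le_abs_self _)

/-- The density `(1 + ‖x‖) ^ (-(n + 1))` is integrable, at most `1`, and bounded below on balls.
Convergence in this single measure gives local convergence on every ball, with no diagonal argument.
-/
lemma exists_finite_measure_le_volume (n : ℕ) : ∃ μ : Measure (Space n), IsFiniteMeasure μ ∧
    μ ≤ volume ∧ ∀ R : ℝ, ∃ c : ℝ≥0∞, c ≠ ⊤ ∧ ∀ S : Set (Space n), MeasurableSet S →
      volume (S ∩ Metric.closedBall 0 R) ≤ c * μ S := by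
  let r : ℝ := n + 1
  have hr : 0 < r := by positivity
  let w : Space n → ℝ≥0∞ := fun x => ENNReal.ofReal ((1 + ‖x‖) ^ (-r))
  have hw : Measurable w := by
    have : Measurable fun x : Space n => (1 + ‖x‖) ^ (-r) := by fun_prop
    exact this.ennreal_ofReal
  refine ⟨volume.withDensity w, ?_, ?_, fun R => ?_⟩
  · refine isFiniteMeasure_withDensity (finite_integral_one_add_norm ?_).ne
    simp [r]
  · calc volume.withDensity w ≤ volume.withDensity 1 := by
          refine withDensity_mono (Eventually.of_forall fun x => ?_)
          refine ENNReal.ofReal_le_one.2 (Real.rpow_le_one_of_one_le_of_nonpos ?_ ?_)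
          · linarith [norm_nonneg x]
          · linarith
      _ = volume := withDensity_one
  · rcases lt_or_ge R 0 with hR | hR
    · exact ⟨0, ENNReal.zero_ne_top, fun S _ => by simp [Metric.closedBall_eq_empty.2 hR]⟩
    have hc : 0 < (1 + R) ^ (-r) := by positivity
    have hc0 : ENNReal.ofReal ((1 + R) ^ (-r)) ≠ 0 := (ENNReal.ofReal_pos.2 hc).ne'
    refine ⟨(ENNReal.ofReal ((1 + R) ^ (-r)))⁻¹, ENNReal.inv_ne_top.2 hc0, fun S hS => ?_⟩
    rw [← ENNReal.div_eq_inv_mul, ENNReal.le_div_iff_mul_le (.inl hc0) (.inl ENNReal.ofReal_ne_top),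
      mul_comm, withDensity_apply _ hS, ← setLIntegral_const]
    calc ∫⁻ _ in S ∩ Metric.closedBall 0 R, ENNReal.ofReal ((1 + R) ^ (-r))
        ≤ ∫⁻ x in S ∩ Metric.closedBall 0 R, w x := by
          refine setLIntegral_mono hw fun x hx => ENNReal.ofReal_le_ofReal ?_
          have : ‖x‖ ≤ R := mem_closedBall_zero_iff.1 hx.2
          exact Real.rpow_le_rpow_of_nonpos (by positivity) (by linarith) (by linarith)
      _ ≤ ∫⁻ x in S, w x := lintegral_mono_set Set.inter_subset_left

/-- Compactness of finite families of sets which are uniformly little moved by translations. -/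
theorem exists_subseq_of_shiftDiff_le {ι : Type*} [Fintype ι] {E : ℕ → ι → Set (Space n)}
    (hE : ∀ k l, MeasurableSet (E k l)) {P : ℝ} (hP : 0 ≤ P)
    (hEP : ∀ k l z, shiftDiff (E k l) z ≤ ENNReal.ofReal (P * ‖z‖)) :
    ∃ ψ : ℕ → ℕ, StrictMono ψ ∧ ∃ A : ι → Set (Space n), (∀ l, MeasurableSet (A l)) ∧
      ∀ l R, Tendsto (fun k => volume ((E (ψ k) l ∆ A l) ∩ Metric.closedBall 0 R)) atTop (𝓝 0) := by
  obtain ⟨μ, hμf, hμ, hμR⟩ := exists_finite_measure_le_volume n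
  let E' : ℕ → ι → MeasuredSets μ := fun k l => ⟨E k l, hE k l⟩
  have hcpt : IsCompact (closure (MeasuredSets.toL1 ''
      {E : MeasuredSets μ | ∀ z, shiftDiff (E : Set (Space n)) z ≤ ENNReal.ofReal (P * ‖z‖)})) :=
    ((totallyBounded_setOfPred_shiftDiff_le μ hμ hP).image
      MeasuredSets.isometry_toL1.uniformContinuous).closure.isCompact_of_isClosed isClosed_closure
  obtain ⟨g, -, ψ, hψ, hg⟩ := (isCompact_univ_pi fun _ : ι => hcpt).tendsto_subseq
    (x := fun k l => MeasuredSets.toL1 (E' k l))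
    fun k l _ => subset_closure (Set.mem_image_of_mem _ (hEP k l))
  rw [tendsto_pi_nhds] at hg
  choose A hA hEA using fun l => exists_limit_set_of_tendsto_toL1 (hg l)
  refine ⟨ψ, hψ, A, hA, fun l R => ?_⟩
  obtain ⟨c, hc, hcR⟩ := hμR R
  have h1 := ENNReal.Tendsto.const_mul (hEA l) (.inr hc)
  rw [mul_zero] at h1
  exact tendsto_of_tendsto_of_tendsto_of_le_of_le tendsto_const_nhds h1 (fun _ => zero_le)
    fun k => hcR _ ((hE _ l).symmDiff (hA l))

/-- Lower semicontinuity of the bound on translations. -/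
lemma shiftDiff_le_of_tendsto {E : ℕ → Set (Space n)} {A : Set (Space n)}
    (hEA : ∀ R, Tendsto (fun k => volume ((E k ∆ A) ∩ Metric.closedBall 0 R)) atTop (𝓝 0))
    {z : Space n} {c : ℝ≥0∞} (hE : ∀ k, shiftDiff (E k) z ≤ c) : shiftDiff A z ≤ c := by
  have hR : ∀ R : ℝ, volume ((A ∆ ((fun x => x + z) ⁻¹' A)) ∩ Metric.closedBall 0 R) ≤ c := by
    intro R
    have h1 := ((hEA R).add (hEA (R + ‖z‖))).add_const c
    rw [add_zero, zero_add] at h1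
    refine ge_of_tendsto' h1 fun k => ?_
    -- If `A` separates `x` from `x + z`, then `A` and `E k` disagree at `x` or at `x + z`, or `E k`
    -- separates them too.
    have hsub : (A ∆ ((fun x => x + z) ⁻¹' A)) ∩ Metric.closedBall 0 R ⊆
        ((E k ∆ A) ∩ Metric.closedBall 0 R) ∪
          ((fun x => x + z) ⁻¹' ((E k ∆ A) ∩ Metric.closedBall 0 (R + ‖z‖))) ∪
          (E k ∆ ((fun x => x + z) ⁻¹' E k)) := by
      rintro x ⟨hx, hxR⟩
      have hxR' : x + z ∈ Metric.closedBall (0 : Space n) (R + ‖z‖) := by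
        rw [mem_closedBall_zero_iff] at hxR ⊢
        exact (norm_add_le x z).trans (by gcongr)
      simp only [Set.mem_symmDiff, Set.mem_preimage, Set.mem_union, Set.mem_inter_iff, hxR, hxR',
        and_true] at hx ⊢
      tauto
    refine (measure_mono hsub).trans ((measure_union_le _ _).trans ?_)
    refine add_le_add ((measure_union_le _ _).trans_eq ?_) (hE k)
    rw [measure_preimage_add_right]
  have h2 : ⋃ N : ℕ, (A ∆ ((fun x => x + z) ⁻¹' A)) ∩ Metric.closedBall 0 (N : ℝ) =
      A ∆ ((fun x => x + z) ⁻¹' A) := by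
    rw [← Set.inter_iUnion, Metric.iUnion_closedBall_nat, Set.inter_univ]
  unfold shiftDiff
  rw [← h2, Monotone.measure_iUnion]
  · exact iSup_le fun N => hR N
  · intro a b hab
    dsimp only
    gcongr

end Compactness

/-! ### Boundary count, covering, and exact partitions -/

section Assembly

variable {n m K : ℕ} {X : Set (Space m)}

/-- If `j` and `j + e_d` differ in phase `l`, one of them is a defect; each defect is counted at
most twice. -/
lemma boundary_phaseLabels_card_le {h M : ℕ} (hh : 1 ≤ h) (hM : 2 ≤ M)
    {v : Fin K → Config n X} (hv : ∀ l, IsPeriodic h (v l)) (hv_inj : Function.Injective v)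
    {u : Config n X} (hfin : (defectLabels h M v u).Finite) (l : Fin K) (d : Fin n) :
    {j | ¬(j ∈ phaseLabels h (v l) u ↔ j + Pi.single d 1 ∈ phaseLabels h (v l) u)}.Finite ∧
      {j | ¬(j ∈ phaseLabels h (v l) u ↔ j + Pi.single d 1 ∈ phaseLabels h (v l) u)}.ncard ≤
        2 * (defectLabels h M v u).ncard := by
  set B := defectLabels h M v u
  have hinj : Function.Injective fun j : IntLattice n => j - Pi.single d 1 := sub_left_injective
  have hsub : {j | ¬(j ∈ phaseLabels h (v l) u ↔ j + Pi.single d 1 ∈ phaseLabels h (v l) u)} ⊆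
      B ∪ (fun j => j - Pi.single d 1) '' B := by
    intro j hj
    by_contra hcon
    simp only [Set.mem_union, Set.mem_image, not_or] at hcon
    refine hj (mem_phaseLabels_iff_of_adjacent hh hM hv hv_inj hcon.1 (fun h' => hcon.2 ?_) l)
    exact ⟨_, h', add_sub_cancel_right _ _⟩
  have hfin' := hfin.union (hfin.image fun j => j - Pi.single d 1)
  refine ⟨hfin'.subset hsub, (Set.ncard_le_ncard hsub hfin').trans ((Set.ncard_union_le _ _).trans ?_)⟩
  rw [Set.ncard_image_of_injective _ hinj, two_mul]

lemma volume_compl_iUnion_phase_le {ε : ℝ} (hε : 0 < ε) {h M : ℕ} (hh : 1 ≤ h) (hM : 2 ≤ M)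
    {v : Fin K → Config n X} {u : Config n X} (hfin : (defectLabels h M v u).Finite) :
    volume (⋃ l, phase h (v l) ε u)ᶜ ≤
      ENNReal.ofReal ((defectLabels h M v u).ncard * (ε * h) ^ n) := by
  have hh' : (0 : ℝ) < h := by exact_mod_cast hh
  have hs : 0 < ε * h := by positivity
  have hsub : (⋃ l, phase h (v l) ε u)ᶜ ⊆
      ⋃ j ∈ hfin.toFinset, {x : Space n | cellIndex (ε * h) x = j} := by
    intro x hx
    simp only [Set.mem_iUnion, Set.Finite.mem_toFinset, Set.mem_ofPred_eq, exists_prop,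
      exists_eq_right']
    by_contra hcon
    obtain ⟨l, hl⟩ := exists_mem_phaseLabels hM hcon
    refine hx (Set.mem_iUnion.2 ⟨l, ?_⟩)
    rw [phase_eq hε hh]
    exact hl
  refine (measure_mono hsub).trans ((measure_biUnion_finset_le _ _).trans_eq ?_)
  simp only [volume_cellIndex_eq hs, Finset.sum_const, nsmul_eq_mul]
  rw [← Set.ncard_eq_toFinset_card _ hfin, ENNReal.ofReal_mul (Nat.cast_nonneg _),
    ENNReal.ofReal_natCast]

lemma measure_eq_zero_of_forall_closedBall {S : Set (Space n)}
    (hS : ∀ R : ℝ, volume (S ∩ Metric.closedBall 0 R) = 0) : volume S = 0 := by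
  rw [← Set.inter_univ S, ← Metric.iUnion_closedBall_nat 0, Set.inter_iUnion]
  exact measure_iUnion_null fun N => hS N

lemma cube_zero_subset_closedBall (R : ℝ) :
    cube (0 : Space n) R ⊆ Metric.closedBall 0 (n * (R / 2)) := by
  intro x hx
  rw [mem_closedBall_zero_iff]
  refine norm_le_of_forall_abs_le fun k => abs_le.2 ?_
  have := hx k
  simp only [PiLp.zero_apply, zero_sub, zero_add] at this
  exact ⟨this.1.le, this.2⟩

/-- Sets which almost form a partition can be modified on a null set so as to form a partition. -/
lemma exists_partition_ae_eq {α : Type*} [MeasurableSpace α] {μ : Measure α} [Nonempty (Fin K)]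
    {A : Fin K → Set α} (hA : ∀ l, MeasurableSet (A l)) (h1 : ∀ᵐ x ∂μ, ∃ l, x ∈ A l)
    (h2 : ∀ l l', l ≠ l' → ∀ᵐ x ∂μ, ¬(x ∈ A l ∧ x ∈ A l')) :
    ∃ A' : Fin K → Set α, (∀ l, MeasurableSet (A' l)) ∧ (∀ l, A' l =ᵐ[μ] A l) ∧
      (Pairwise fun l l' => Disjoint (A' l) (A' l')) ∧ ⋃ l, A' l = Set.univ := by
  obtain ⟨l₀⟩ := ‹Nonempty (Fin K)›
  let D : Fin K → Set α := disjointed A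
  have hD : ∀ l, MeasurableSet (D l) := fun l => by
    simp only [D, disjointed_apply, Finset.sup_set_eq_biUnion]
    exact (hA l).diff (Finset.measurableSet_biUnion _ fun l' _ => hA l')
  have hDA : ⋃ l, D l = ⋃ l, A l := iUnion_disjointed
  have hDd : Pairwise fun l l' => Disjoint (D l) (D l') := disjoint_disjointed A
  have h2' : ∀ᵐ x ∂μ, ∀ l l', l ≠ l' → ¬(x ∈ A l ∧ x ∈ A l') := by
    simp only [ae_all_iff]
    exact h2
  have hDae : ∀ᵐ x ∂μ, ∀ l, x ∈ D l ↔ x ∈ A l := by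
    filter_upwards [h2'] with x hx l
    refine ⟨fun h => disjointed_subset A l h, fun h => ?_⟩
    obtain ⟨l', hl'⟩ := Set.mem_iUnion.1 (hDA.symm ▸ Set.mem_iUnion.2 ⟨l, h⟩ : x ∈ ⋃ l, D l)
    by_cases hll : l = l'
    · rwa [hll]
    · exact absurd ⟨h, disjointed_subset A l' hl'⟩ (hx l l' hll)
  -- The uncovered null set is given to the phase `l₀`.
  refine ⟨fun l => D l ∪ if l = l₀ then (⋃ l, D l)ᶜ else ∅, fun l => ?_, fun l => ?_, ?_, ?_⟩
  · refine (hD l).union ?_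
    split_ifs
    · exact (MeasurableSet.iUnion hD).compl
    · exact MeasurableSet.empty
  · filter_upwards [h1, hDae] with x hx1 hx2
    have hxD : x ∈ ⋃ l, D l := by
      rw [hDA]
      exact Set.mem_iUnion.2 hx1
    apply propext
    change x ∈ D l ∪ _ ↔ x ∈ A l
    rw [Set.mem_union, hx2 l]
    refine or_iff_left fun h => ?_
    split_ifs at h
    · exact h hxD
    · exact h
  · intro l l' hll
    have hempty : ∀ a, Disjoint (D a) (⋃ l, D l)ᶜ := fun a =>
      Set.disjoint_compl_right_iff_subset.2 (Set.subset_iUnion D a)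
    have := hDd hll
    dsimp only
    split_ifs with h3 h4
    · exact absurd (h3.trans h4.symm) hll
    · simp only [Set.union_empty, Set.disjoint_union_left]
      exact ⟨this, (hempty l').symm⟩
    · simp only [Set.union_empty, Set.disjoint_union_right]
      exact ⟨this, hempty l⟩
    · simpa using this
  · rw [Set.iUnion_union_distrib]
    refine Set.eq_univ_of_forall fun x => ?_
    by_cases hx : x ∈ ⋃ l, D l
    · exact Or.inl hx
    · refine Or.inr (Set.mem_iUnion.2 ⟨l₀, ?_⟩)
      rw [if_pos rfl]
      exact hx

lemma shiftDiff_congr_ae {A B : Set (Space n)} (h : A =ᵐ[volume] B) (z : Space n) :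
    shiftDiff A z = shiftDiff B z := by
  refine measure_congr (h.symmDiff ?_)
  exact (quasiMeasurePreserving_add_right volume z).preimage_ae_eq h

end Assembly

end LatticePhases

end
-- The compactness theorem
open LatticePhases in
theorem theorem3p5 {n m K : ℕ} (hn : 1 ≤ n)
    (X : Set (Space m)) (L : ℝ)
    (φ : Config n X → ℝ) (hφ : ∀ u, φ u ∈ Set.Icc 0 L)
    (h : ℕ) (hh : 1 ≤ h)
    (v : Fin K → Config n X) (hv : ∀ l, IsPeriodic h (v l)) (hv_inj : Function.Injective v)
    (H2 : Coercive φ h v)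
    (ε : ℕ → ℝ) (hε_pos : ∀ k, 0 < ε k) (hε : Filter.Tendsto ε Filter.atTop (nhds 0))
    (u : ℕ → Config n X) (hu : ⨆ k, energy φ (ε k) (u k) < ⊤) :
    ∃ ψ : ℕ → ℕ, StrictMono ψ ∧ ∃ A : Fin K → Set (Space n),
      ConvergesTo h v (ε ∘ ψ) (u ∘ ψ) A ∧
      (∀ l, HasFinitePerimeter (A l)) ∧
      (Pairwise fun l l' => Disjoint (A l) (A l')) ∧ ⋃ l, A l = Set.univ := by
  obtain ⟨M, M', hM, -, C, hC, hcoer⟩ := H2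
  set W := (⨆ k, energy φ (ε k) (u k)).toReal
  have hen : ∀ k, energy φ (ε k) (u k) ≠ ⊤ := fun k =>
    ((le_iSup (fun k => energy φ (ε k) (u k)) k).trans_lt hu).ne
  have hW : ∀ k, (energy φ (ε k) (u k)).toReal ≤ W := fun k =>
    ENNReal.toReal_mono hu.ne (le_iSup (fun k => energy φ (ε k) (u k)) k)
  have hW0 : 0 ≤ W := ENNReal.toReal_nonneg
  have hh' : (0 : ℝ) < h := by exact_mod_cast hh
  have hs : ∀ k, 0 < ε k * h := fun k => mul_pos (hε_pos k) hh'
  have hdef := fun k => defectLabels_card_le hh hC hcoer (hε_pos k) (u k) (hen k)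
  let N : ℕ → ℕ := fun k => (defectLabels h M v (u k)).ncard
  -- Bounds `N k * (ε k * h) ^ (n - 1)`, the number of defects times the area of a cell face.
  let P : ℝ := (2 * M' + 1) ^ n * W / C * h ^ (n - 1)
  have hP0 : 0 ≤ P := by positivity
  have hNP : ∀ k, (N k : ℝ) * (ε k * h) ^ (n - 1) ≤ P := fun k => by
    rw [mul_pow, ← mul_assoc]
    refine mul_le_mul_of_nonneg_right ((hdef k).2.trans ?_) (by positivity)
    gcongr
    exact hW k
  have hmeas : ∀ k l, MeasurableSet (phase h (v l) (ε k) (u k)) := fun k l => by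
    rw [phase_eq (hε_pos k) hh]
    exact measurableSet_cellIndex_preimage _ _
  have hshift : ∀ k l z, shiftDiff (phase h (v l) (ε k) (u k)) z ≤
      ENNReal.ofReal (n * (2 * P) * ‖z‖) := fun k l z => by
    rw [phase_eq (hε_pos k) hh]
    refine shiftDiff_cellIndex_preimage_le (hs k) (fun d => ?_) (by positivity) z
    obtain ⟨h1, h2⟩ := boundary_phaseLabels_card_le hh hM hv hv_inj (hdef k).1 l d
    refine ⟨h1, ?_⟩
    have h3 : ({j | ¬(j ∈ phaseLabels h (v l) (u k) ↔
        j + Pi.single d 1 ∈ phaseLabels h (v l) (u k))}.ncard : ℝ) ≤ 2 * N k := by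
      exact_mod_cast h2
    calc _ ≤ 2 * (N k : ℝ) * (ε k * h) ^ (n - 1) :=
          mul_le_mul_of_nonneg_right h3 (pow_nonneg (hs k).le _)
      _ = 2 * (N k * (ε k * h) ^ (n - 1)) := by ring
      _ ≤ 2 * P := by
          have := hNP k
          gcongr
  obtain ⟨ψ, hψ, A, hA, hlim⟩ := exists_subseq_of_shiftDiff_le hmeas
    (by positivity : 0 ≤ n * (2 * P)) hshift
  have hcov : Tendsto (fun k => volume (⋃ l, phase h (v l) (ε k) (u k))ᶜ) atTop (𝓝 0) := by
    have h1 : Tendsto (fun k => ENNReal.ofReal (P * (ε k * h))) atTop (𝓝 0) := by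
      have := ENNReal.tendsto_ofReal ((hε.mul_const (h : ℝ)).const_mul P)
      simpa using this
    refine tendsto_of_tendsto_of_tendsto_of_le_of_le tendsto_const_nhds h1 (fun _ => zero_le)
      fun k => ?_
    refine (volume_compl_iUnion_phase_le (hε_pos k) hh hM (hdef k).1).trans
      (ENNReal.ofReal_le_ofReal ?_)
    -- Since `n ≥ 1`, the truncated exponent `n - 1` is genuine, and the defect volume is at most
    -- `P` times one more factor `ε k * h`.
    obtain ⟨q, rfl⟩ : ∃ q, n = q + 1 := ⟨n - 1, by omega⟩
    rw [pow_succ, ← mul_assoc]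
    exact mul_le_mul_of_nonneg_right (hNP k) (hs k).le
  have hsum : ∀ R, Tendsto (fun k => ∑ l, volume
      ((phase h (v l) (ε (ψ k)) (u (ψ k)) ∆ A l) ∩ Metric.closedBall 0 R)) atTop (𝓝 0) := fun R => by
    have := tendsto_finsetSum Finset.univ fun l _ => hlim l R
    simpa using this
  have hA1 : ∀ᵐ x, ∃ l, x ∈ A l := by
    rw [ae_iff]
    refine measure_eq_zero_of_forall_closedBall fun R => ?_
    have h1 := (hcov.comp hψ.tendsto_atTop).add (hsum R)
    rw [add_zero] at h1
    refine le_antisymm (ge_of_tendsto' h1 fun k => ?_) zero_le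
    refine le_trans (measure_mono ?_) ((measure_union_le _ _).trans
      (add_le_add_right (measure_iUnion_fintype_le _ _) _))
    rintro x ⟨hx, hxR⟩
    by_cases hx' : x ∈ ⋃ l, phase h (v l) (ε (ψ k)) (u (ψ k))
    · right
      obtain ⟨l, hl⟩ := Set.mem_iUnion.1 hx'
      exact Set.mem_iUnion.2 ⟨l, Or.inl ⟨hl, fun h' => hx ⟨l, h'⟩⟩, hxR⟩
    · exact Or.inl hx'
  have hA2 : ∀ l l', l ≠ l' → ∀ᵐ x, ¬(x ∈ A l ∧ x ∈ A l') := by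
    intro l l' hll
    rw [ae_iff]
    refine measure_eq_zero_of_forall_closedBall fun R => ?_
    have h1 := (hlim l R).add (hlim l' R)
    rw [add_zero] at h1
    refine le_antisymm (ge_of_tendsto' h1 fun k => ?_) zero_le
    refine (measure_mono ?_).trans (measure_union_le _ _)
    rintro x ⟨hx, hxR⟩
    obtain ⟨hxl, hxl'⟩ := not_not.1 hx
    by_cases hx' : x ∈ phase h (v l) (ε (ψ k)) (u (ψ k))
    · refine Or.inr ⟨Or.inr ⟨hxl', fun h' => ?_⟩, hxR⟩
      rw [phase_eq (hε_pos _) hh] at hx' h'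
      exact Set.disjoint_left.1
        (disjoint_phaseLabels hh (hv l) (hv l') (hv_inj.ne hll) (u (ψ k))) hx' h'
    · exact Or.inl ⟨Or.inr ⟨hxl, hx'⟩, hxR⟩
  -- Space has positive measure and is almost covered by the `A l`, so bounded energy excludes `K =
  -- 0`.
  have hne : Nonempty (Fin K) := by
    obtain ⟨x, l, -⟩ := hA1.exists
    exact ⟨l⟩
  obtain ⟨A', hA'm, hA'A, hA'd, hA'u⟩ := exists_partition_ae_eq hA hA1 hA2
  refine ⟨ψ, hψ, A', fun l R _ => ?_, fun l => ?_, hA'd, hA'u⟩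
  · refine tendsto_of_tendsto_of_tendsto_of_le_of_le tendsto_const_nhds (hlim l (n * (R / 2)))
      (fun _ => zero_le) fun k => ?_
    refine (measure_mono (Set.inter_subset_inter_right _ (cube_zero_subset_closedBall R))).trans_eq ?_
    exact measure_congr (((ae_eq_refl _).symmDiff (hA'A l)).inter (ae_eq_refl _))
  · refine hasFinitePerimeter_of_shiftDiff_le (hA'm l) (P := n * (2 * P)) (by positivity) fun z => ?_
    rw [shiftDiff_congr_ae (hA'A l)]
    exact shiftDiff_le_of_tendsto (hlim l) fun k => hshift (ψ k) l z
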